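/- Consider a gateway at the origin of $\mathbb{R}^2$ and a device at distance $r_o>0$ from it that transmits with constant power $P>0$. Let the path-loss exponent be $\eta>2$, the noise power $\sigma^2\ge 0$, the inter-device and inter-line spacings $\Delta x,\Delta y>0$, the communication range $R>0$ and the number of devices per gateway $\mathcal N_G\ge 1$ (of which one is active at a time). Packets of $L>0$ bits are split into $m\ge 1$ segments, each sent in a slot of length $T_s>0$ over bandwidth $W>0$ at rate $\mathcal R_m=\frac{L}{mT_s}=\zeta W\log_2(1+\Xi_m)$ with $0<\zeta\le 1$, so that the decoding threshold is $\Xi_m=2^{L/(m\zeta WT_s)}-1$. In the 2-D PPP approximation, the locations $v_1,v_2,\dots$ of the interfering devices form a Poisson point process of constant intensity $\lambda=\frac{1}{\Delta x\,\Delta y\,\mathcal N_G}$ on $\{v\in\mathbb{R}^2:\|v\|\ge \frac{\sqrt3R}{2}\}$. The fading gains $h_o,h_1,h_2,\dots$ are i.i.d. exponential random variables with mean one, independent of the locations. For omni-directional gateways and omni-directional devices (O-GW and O-N, all antenna gains equal to one) with constant power $P$ for all devices, $$\mathrm{SINR}=\frac{P\,h_o\,r_o^{-\eta}}{\sigma^2+\sum_{i\ge1}P\,h_i\,\|v_i\|^{-\eta}},\qquad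 p_m=\mathbb P\{\mathrm{SINR}>\Xi_m\}.$$ Then the series in the denominator converges almost surely, and the segment transmission success probability is $$p_m=\exp\left\{-\frac{\Xi_m r_o^{\eta}\sigma^2}{P}-\frac{2\pi\,\Xi_m r_o^{\eta}\left(\frac{\sqrt3R}{2}\right)^{2-\eta}}{\Delta x\,\Delta y\,\mathcal N_G\,(\eta-2)}\;{}_2F_1\!\left(1,1-\frac2\eta;2-\frac2\eta;\frac{-\Xi_m r_o^{\eta}}{\left(\frac{\sqrt3R}{2}\right)^{\eta}}\right)\right\},$$ where ${}_2F_1(a,b;c;x)$ is the Gauss hypergeometric function, that is, for real $x<1$, the analytic continuation to $(-\infty,1)$ of the series $\sum_{n\ge0}\frac{(a)_n(b)_n}{(c)_n}\frac{x^n}{n!}$. -/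

import Mathlib

open MeasureTheory ProbabilityTheory

noncomputable section

/-! ### Gauss hypergeometric function -/

/-- `F` is a real-analytic continuation to `(-∞, 1)` of the Gauss hypergeometric series
`∑ (a)ₙ (b)ₙ / (c)ₙ · xⁿ / n!`, which converges for `|x| < 1`. -/
def IsHypergeometricContinuation (a b c : ℝ) (F : ℝ → ℝ) : Prop :=
  AnalyticOnNhd ℝ F (Set.Iio 1) ∧
    ∀ x : ℝ, |x| < 1 → F x = ordinaryHypergeometric a b c x

/-- Two analytic continuations of the hypergeometric series agree on `(-∞, 1)`. -/
theorem IsHypergeometricContinuation.eqOn {a b c : ℝ} {F G : ℝ → ℝ}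
    (hF : IsHypergeometricContinuation a b c F) (hG : IsHypergeometricContinuation a b c G) :
    Set.EqOn F G (Set.Iio 1) := by
  refine hF.1.eqOn_of_preconnected_of_eventuallyEq hG.1 isPreconnected_Iio
    (z₀ := 0) (by simp) ?_
  filter_upwards [Metric.ball_mem_nhds (0 : ℝ) one_pos] with x hx
  have hx' : |x| < 1 := by simpa using hx
  rw [hF.2 x hx', hG.2 x hx']

open Classical in
/-- The Gauss hypergeometric function `₂F₁(a, b; c; x)` for real parameters and real `x < 1`
(principal branch): the analytic continuation of the hypergeometric series to `(-∞, 1)`. Mathlib's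
`ordinaryHypergeometric` is the sum of the series, hence meaningful only for `|x| < 1`. -/
def gaussHypergeometric (a b c x : ℝ) : ℝ :=
  if h : ∃ F : ℝ → ℝ, IsHypergeometricContinuation a b c F then h.choose x else 0

/-- Any analytic continuation computes the Gauss hypergeometric function. -/
theorem IsHypergeometricContinuation.gaussHypergeometric_eq {a b c : ℝ} {F : ℝ → ℝ}
    (hF : IsHypergeometricContinuation a b c F) {x : ℝ} (hx : x < 1) :
    gaussHypergeometric a b c x = F x := by
  have h : ∃ F : ℝ → ℝ, IsHypergeometricContinuation a b c F := ⟨F, hF⟩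
  rw [gaussHypergeometric, dif_pos h]
  exact h.choose_spec.eqOn hF hx

/-! ### Poisson point processes -/

/-- The number of indices `i` with `X i ω ∈ B`. -/
def pointCount {Ω E : Type*} (X : ℕ → Ω → E) (B : Set E) (ω : Ω) : ℕ∞ :=
  {i : ℕ | X i ω ∈ B}.encard

/-- The random points `X 0, X 1, X 2, …` enumerate, under `μ`, a Poisson point process on `E` with
intensity measure `Λ` (of infinite total mass): the number of points in a measurable set `B` of
finite intensity is Poisson distributed with mean `Λ B`, and the numbers of points in finitely many
pairwise disjoint measurable sets are independent. -/
structure IsPoissonPointProcess {Ω E : Type*} [MeasurableSpace Ω] [MeasurableSpace E]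
    (X : ℕ → Ω → E) (Λ : Measure E) (μ : Measure Ω) : Prop where
  measurable : ∀ i, Measurable (X i)
  hasLaw_count : ∀ B : Set E, MeasurableSet B → Λ B ≠ ⊤ →
    HasLaw (pointCount X B) ((poissonMeasure (Λ B).toNNReal).map (Nat.cast : ℕ → ℕ∞)) μ
  indep_count : ∀ (n : ℕ) (B : Fin n → Set E), (∀ k, MeasurableSet (B k)) →
    Pairwise (fun j k => Disjoint (B j) (B k)) → iIndepFun (fun k => pointCount X (B k)) μ

/-! ### The network model -/

/-- The plane, with its Euclidean norm and Lebesgue measure. -/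
abbrev Plane : Type := EuclideanSpace ℝ (Fin 2)

/-- The SINR threshold `Ξ = 2 ^ (L / (m ζ W Tₛ)) - 1` at which the rate `L / (m Tₛ)` of a segment
equals `ζ W log₂ (1 + Ξ)`. -/
def sinrThreshold (L : ℝ) (m : ℕ) (ζ W Ts : ℝ) : ℝ :=
  (2 : ℝ) ^ (L / (m * ζ * W * Ts)) - 1

/-- The density of simultaneously active devices: the devices have density `1 / (Δx Δy)`, and one
out of the `NG` devices of each gateway is active. -/
def activeDensity (Δx Δy : ℝ) (NG : ℕ) : ℝ := 1 / (Δx * Δy * NG)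

/-- Intensity measure of the interferers in the 2-D PPP approximation: homogeneous of density
`lam`, outside the interference-free disc of radius `√3 R / 2` around the test gateway. -/
def interfererIntensity (lam R : ℝ) : Measure Plane :=
  ENNReal.ofReal lam • (volume : Measure Plane).restrict {v | √3 * R / 2 ≤ ‖v‖}

/-- The 2-D PPP approximation. The test gateway is at the origin, `X i` is the location of the
`i`-th interferer, `h none` the fading gain of the intended link, and `h (some i)` the fading gain
of the link from the `i`-th interferer. The fading gains are i.i.d. exponential of mean one, and
independent of the locations. -/
structure IsTwoDimPPPModel {Ω : Type*} [MeasurableSpace Ω] (μ : Measure Ω) (lam R : ℝ)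
    (X : ℕ → Ω → Plane) (h : Option ℕ → Ω → ℝ) : Prop where
  locations : IsPoissonPointProcess X (interfererIntensity lam R) μ
  fading_law : ∀ k, HasLaw (h k) (expMeasure 1) μ
  fading_indep : iIndepFun h μ
  fading_indep_locations : IndepFun (fun ω k => h k ω) (fun ω i => X i ω) μ

/-- Power received at the test gateway from the `i`-th interferer, for omni-directional antennas
(unit gains) and constant transmission power `P`. -/
def interferencePower {Ω : Type*} (P η : ℝ) (X : ℕ → Ω → Plane) (h : Option ℕ → Ω → ℝ)
    (ω : Ω) (i : ℕ) : ℝ :=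
  P * h (some i) ω * ‖X i ω‖ ^ (-η)

/-- The signal-to-interference-plus-noise ratio at the test gateway for omni-directional gateways
and devices, constant transmission power `P`, noise power `σ ^ 2` and intended link distance
`ro`. -/
def sinr {Ω : Type*} (P η σ ro : ℝ) (X : ℕ → Ω → Plane) (h : Option ℕ → Ω → ℝ) (ω : Ω) : ℝ :=
  (P * h none ω * ro ^ (-η)) / (σ ^ 2 + ∑' i, interferencePower P η X h ω i)

/-- The segment transmission success probability: the probability that the SINR exceeds `Ξ`. -/
def successProb {Ω : Type*} [MeasurableSpace Ω] (μ : Measure Ω) (P η σ ro Ξ : ℝ)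
    (X : ℕ → Ω → Plane) (h : Option ℕ → Ω → ℝ) : ℝ :=
  μ.real {ω | Ξ < sinr P η σ ro X h ω}

end

/-!
Under Rayleigh fading, `SINR > Ξ` says that the exponential gain `h none` exceeds `A + T I`, where
`T = Ξ ro ^ η`, `A = T σ² / P` and `I = ∑ h (some i) ‖X i‖ ^ (-η)`; given everything else this has
probability `e ^ (-A - T I)`. Averaging out the fading, an interferer at `v` contributes the factor
`1 / (1 + T ‖v‖ ^ (-η))` to the Laplace transform `𝔼[e ^ (-T I)]`, which by the Laplace functional
of the Poisson process is `exp (-∫ T ‖v‖ ^ (-η) / (1 + T ‖v‖ ^ (-η)))`. In polar coordinates, with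
`a = √3 R / 2`, the substitution `t = (‖v‖ / a) ^ (-η)` turns the exponent into Euler's integral
for `₂F₁(1, b; b + 1; -T / a ^ η)`, where `b = 1 - 2 / η`.
-/

open Filter
open scoped ENNReal NNReal Topology

noncomputable section

/-- The function `x ↦ exp (-x)` on `[0, ∞]`, with value `0` at `∞`. Laplace transforms of sums of
nonnegative random variables are taken with it, so that no convergence has to be known first. -/
def negExp (x : ℝ≥0∞) : ℝ≥0∞ := EReal.exp (-(x : EReal))

@[simp] lemma negExp_zero : negExp 0 = 1 := by simp [negExp]

@[simp] lemma negExp_top : negExp ⊤ = 0 := by simp [negExp]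

lemma negExp_ofReal {x : ℝ} (hx : 0 ≤ x) :
    negExp (ENNReal.ofReal x) = ENNReal.ofReal (Real.exp (-x)) := by
  rw [negExp, EReal.coe_ennreal_ofReal, max_eq_left hx, ← EReal.coe_neg, EReal.exp_coe]

lemma continuous_negExp : Continuous negExp :=
  EReal.expHomeomorph.continuous.comp (continuous_neg.comp continuous_coe_ennreal_ereal)

@[fun_prop] lemma measurable_negExp : Measurable negExp := continuous_negExp.measurable

lemma antitone_negExp : Antitone negExp := fun _ _ hxy =>
  EReal.exp_monotone (EReal.neg_le_neg_iff.2 (EReal.coe_ennreal_le_coe_ennreal_iff.2 hxy))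

lemma negExp_le_one (x : ℝ≥0∞) : negExp x ≤ 1 := by
  simpa using antitone_negExp (zero_le (a := x))

lemma negExp_add (x y : ℝ≥0∞) : negExp (x + y) = negExp x * negExp y := by
  rw [negExp, negExp, negExp, ← EReal.exp_add, EReal.coe_ennreal_add,
    EReal.neg_add (.inl (EReal.coe_ennreal_ne_bot x)) (.inr (EReal.coe_ennreal_ne_bot y)),
    sub_eq_add_neg]

lemma negExp_sum {ι : Type*} (s : Finset ι) (f : ι → ℝ≥0∞) :
    negExp (∑ i ∈ s, f i) = ∏ i ∈ s, negExp (f i) := by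
  classical
  induction s using Finset.induction_on with
  | empty => simp
  | insert a s ha ih => rw [Finset.sum_insert ha, Finset.prod_insert ha, negExp_add, ih]

lemma negExp_mul_natCast (x : ℝ≥0∞) (n : ℕ) : negExp (x * n) = negExp x ^ n := by
  simpa [mul_comm] using negExp_sum (Finset.range n) fun _ => x

lemma tendsto_negExp_sum_range (f : ℕ → ℝ≥0∞) :
    Tendsto (fun n => negExp (∑ i ∈ Finset.range n, f i)) atTop (𝓝 (negExp (∑' i, f i))) :=
  (continuous_negExp.tendsto _).comp (ENNReal.tendsto_nat_tsum f)

lemma negExp_toENNReal_neg_log {q : ℝ≥0∞} (hq : q ≤ 1) :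
    negExp (-(ENNReal.log q)).toENNReal = q := by
  have hlog : ENNReal.log q ≤ 0 := ENNReal.log_le_zero_iff.2 hq
  rw [negExp, EReal.coe_toENNReal (EReal.neg_nonneg.2 hlog), neg_neg, ENNReal.exp_log]

lemma tendsto_lintegral_negExp {Ω : Type*} [MeasurableSpace Ω] {μ : Measure Ω} [IsFiniteMeasure μ]
    {f : ℕ → Ω → ℝ≥0∞} {g : Ω → ℝ≥0∞} (hf : ∀ n, AEMeasurable (f n) μ)
    (h : ∀ᵐ ω ∂μ, Tendsto (fun n => negExp (f n ω)) atTop (𝓝 (negExp (g ω)))) :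
    Tendsto (fun n => ∫⁻ ω, negExp (f n ω) ∂μ) atTop (𝓝 (∫⁻ ω, negExp (g ω) ∂μ)) :=
  tendsto_lintegral_of_dominated_convergence' (fun _ => 1)
    (fun n => measurable_negExp.comp_aemeasurable (hf n))
    (fun n => ae_of_all _ fun ω => negExp_le_one _) (by simp) h

/-! ### Laplace functional of a Poisson point process -/

lemma lintegral_pow_poissonMeasure (r : ℝ≥0) {q : ℝ≥0∞} (hq : q ≤ 1) :
    ∫⁻ n, q ^ n ∂(poissonMeasure r) = negExp (r * (1 - q)) := by
  lift q to ℝ≥0 using (hq.trans_lt ENNReal.one_lt_top).ne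
  have hq' : q ≤ 1 := by exact_mod_cast hq
  have hterm (n : ℕ) : (q : ℝ≥0∞) ^ n * poissonMeasure r {n}
      = ENNReal.ofReal (Real.exp (-r) * ((r * q) ^ n / n.factorial)) := by
    rw [poissonMeasure_singleton, ← ENNReal.ofReal_coe_nnreal (p := q),
      ← ENNReal.ofReal_pow q.coe_nonneg, ← ENNReal.ofReal_mul (by positivity), mul_pow]
    congr 1
    ring
  have hseries : HasSum (fun n : ℕ => Real.exp (-r) * ((r * q : ℝ) ^ n / n.factorial))
      (Real.exp (-r) * Real.exp (r * q)) := by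
    rw [Real.exp_eq_exp_ℝ]
    exact (NormedSpace.expSeries_div_hasSum_exp (r * q : ℝ)).mul_left _
  have hexponent : (r : ℝ≥0∞) * (1 - q) = ENNReal.ofReal (r * (1 - q)) := by
    rw [ENNReal.ofReal_mul r.coe_nonneg, ENNReal.ofReal_sub _ q.coe_nonneg]
    simp
  rw [lintegral_countable']
  simp_rw [hterm]
  rw [← ENNReal.ofReal_tsum_of_nonneg (fun n => by positivity) hseries.summable, hseries.tsum_eq,
    ← Real.exp_add, hexponent,
    negExp_ofReal (mul_nonneg r.coe_nonneg (sub_nonneg.2 (by exact_mod_cast hq')))]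
  congr 2
  ring

lemma tsum_indicator_const_eq_mul_pointCount {Ω E : Type*} (X : ℕ → Ω → E) (B : Set E) (c : ℝ≥0∞)
    (ω : Ω) : ∑' i, B.indicator (fun _ => c) (X i ω) = c * (pointCount X B ω : ℝ≥0∞) := by
  rw [pointCount, mul_comm, ← ENNReal.tsum_set_const, tsum_subtype {i | X i ω ∈ B} fun _ => c]
  rfl

lemma tsum_simpleFunc_eq_sum_mul_pointCount {Ω E : Type*} [MeasurableSpace E] (X : ℕ → Ω → E)
    (f : SimpleFunc E ℝ≥0∞) (ω : Ω) :
    ∑' i, f (X i ω) = ∑ y : f.range, (y : ℝ≥0∞) * (pointCount X (f ⁻¹' {(y : ℝ≥0∞)}) ω : ℝ≥0∞) := by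
  classical
  have hf (v : E) : f v = ∑ y ∈ f.range, (f ⁻¹' {y}).indicator (fun _ => y) v := by
    simp [Set.indicator_apply]
  simp_rw [← tsum_indicator_const_eq_mul_pointCount]
  rw [Finset.sum_coe_sort f.range fun y => ∑' i, (f ⁻¹' {y}).indicator (fun _ => y) (X i ω),
    ← Summable.tsum_finsetSum fun _ _ => ENNReal.summable]
  exact tsum_congr fun i => hf _

lemma tendsto_ennreal_tsum_of_monotone {f : ℕ → ℕ → ℝ≥0∞} {g : ℕ → ℝ≥0∞}
    (hf : ∀ i, Monotone fun n => f n i) (h : ∀ i, Tendsto (fun n => f n i) atTop (𝓝 (g i))) :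
    Tendsto (fun n => ∑' i, f n i) atTop (𝓝 (∑' i, g i)) := by
  simp_rw [← lintegral_count]
  exact lintegral_tendsto_of_tendsto_of_monotone (fun n => measurable_from_top.aemeasurable)
    (ae_of_all _ hf) (ae_of_all _ h)

lemma exists_simpleFunc_monotone_tendsto {E : Type*} [MeasurableSpace E] (Λ : Measure E)
    [SigmaFinite Λ] {φ : E → ℝ≥0∞} (hφ : Measurable φ) :
    ∃ f : ℕ → SimpleFunc E ℝ≥0∞, (∀ n, ∀ y ≠ 0, Λ (f n ⁻¹' {y}) ≠ ⊤) ∧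
      (∀ v, Monotone fun n => f n v) ∧ ∀ v, Tendsto (fun n => f n v) atTop (𝓝 (φ v)) := by
  have hS := measurableSet_spanningSets Λ
  refine ⟨fun n => (SimpleFunc.eapprox φ n).restrict (spanningSets Λ n), fun n y hy => ?_,
    fun v m n hmn => ?_, fun v => ?_⟩
  · rw [SimpleFunc.restrict_preimage_singleton _ (hS n) hy]
    exact measure_ne_top_of_subset Set.inter_subset_left (measure_spanningSets_lt_top Λ n).ne
  · simp only [SimpleFunc.restrict_apply _ (hS _)]
    exact (Set.indicator_le_indicator (SimpleFunc.monotone_eapprox φ hmn v)).trans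
      (Set.indicator_le_indicator_of_subset (monotone_spanningSets Λ hmn) (fun _ => zero_le) v)
  · have heapprox : Tendsto (fun n => SimpleFunc.eapprox φ n v) atTop (𝓝 (φ v)) := by
      rw [← SimpleFunc.iSup_eapprox_apply hφ v]
      exact tendsto_atTop_iSup fun m n hmn => SimpleFunc.monotone_eapprox φ hmn v
    refine heapprox.congr' ?_
    filter_upwards [eventually_mem_spanningSets Λ v] with n hn
    rw [SimpleFunc.restrict_apply _ (hS n), Set.indicator_of_mem hn]

namespace IsPoissonPointProcess

variable {Ω E : Type*} [MeasurableSpace Ω] [MeasurableSpace E] {X : ℕ → Ω → E} {Λ : Measure E}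
  {μ : Measure Ω}

lemma measurable_pointCount (hX : IsPoissonPointProcess X Λ μ) {B : Set E}
    (hB : MeasurableSet B) : Measurable fun ω => (pointCount X B ω : ℝ≥0∞) := by
  have hcount (ω : Ω) : (pointCount X B ω : ℝ≥0∞) = ∑' i, B.indicator (fun _ => 1) (X i ω) := by
    rw [tsum_indicator_const_eq_mul_pointCount, one_mul]
  simp_rw [hcount]
  exact Measurable.tsum fun i => (measurable_const.indicator hB).comp (hX.measurable i)

lemma ae_notMem (hX : IsPoissonPointProcess X Λ μ) {B : Set E} (hB : MeasurableSet B)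
    (hΛ : Λ B = 0) : ∀ᵐ ω ∂μ, ∀ i, X i ω ∉ B := by
  have hlaw := hX.hasLaw_count B hB (by simp [hΛ])
  rw [hΛ, ENNReal.toNNReal_zero] at hlaw
  have hzero : ∀ᵐ n ∂((poissonMeasure 0).map (Nat.cast : ℕ → ℕ∞)), n = 0 := by
    rw [ae_map_iff (p := fun n : ℕ∞ => n = 0) measurable_from_top.aemeasurable
      (measurableSet_singleton 0)]
    simp only [Nat.cast_eq_zero]
    exact (prob_compl_eq_zero_iff (measurableSet_singleton 0)).2
      (by simp [poissonMeasure_singleton])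
  filter_upwards [(hlaw.ae_iff (p := fun n => n = 0) measurable_from_top).2 hzero] with ω hω
  exact Set.eq_empty_iff_forall_notMem.1 (Set.encard_eq_zero.1 hω)

lemma lintegral_negExp_mul_pointCount (hX : IsPoissonPointProcess X Λ μ) {B : Set E}
    (hB : MeasurableSet B) (hΛ : Λ B ≠ ⊤) (c : ℝ≥0∞) :
    ∫⁻ ω, negExp (c * (pointCount X B ω : ℝ≥0∞)) ∂μ = negExp ((1 - negExp c) * Λ B) := by
  have hm : Measurable fun n : ℕ∞ => negExp (c * (n : ℝ≥0∞)) := measurable_from_top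
  rw [(hX.hasLaw_count B hB hΛ).lintegral_comp (f := fun n : ℕ∞ => negExp (c * (n : ℝ≥0∞)))
    hm.aemeasurable, lintegral_map hm measurable_from_top]
  simp only [ENat.toENNReal_coe, negExp_mul_natCast]
  rw [lintegral_pow_poissonMeasure _ (negExp_le_one c), ENNReal.coe_toNNReal hΛ, mul_comm]

lemma iIndepFun_pointCount (hX : IsPoissonPointProcess X Λ μ) {ι : Type*} [Finite ι]
    {B : ι → Set E} (hB : ∀ k, MeasurableSet (B k))
    (hdisj : Pairwise fun j k => Disjoint (B j) (B k)) :
    iIndepFun (fun k => pointCount X (B k)) μ := by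
  obtain ⟨n, ⟨e⟩⟩ := Finite.exists_equiv_fin ι
  exact iIndepFun.of_precomp e.symm.surjective <| hX.indep_count n (fun k => B (e.symm k))
    (fun k => hB _) fun j k hjk => hdisj (e.symm.injective.ne hjk)

lemma laplace_simpleFunc [IsProbabilityMeasure μ] (hX : IsPoissonPointProcess X Λ μ)
    (f : SimpleFunc E ℝ≥0∞) (hΛ : ∀ y ≠ 0, Λ (f ⁻¹' {y}) ≠ ⊤) :
    ∫⁻ ω, negExp (∑' i, f (X i ω)) ∂μ = negExp (∫⁻ v, (1 - negExp (f v)) ∂Λ) := by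
  have hdisj : Pairwise fun y z : f.range =>
      Disjoint (f ⁻¹' {(y : ℝ≥0∞)}) (f ⁻¹' {(z : ℝ≥0∞)}) := fun y z hyz =>
    Disjoint.preimage f (Set.disjoint_singleton.2 (Subtype.coe_injective.ne hyz))
  have hindep : iIndepFun (fun (y : f.range) ω =>
      negExp (y * (pointCount X (f ⁻¹' {(y : ℝ≥0∞)}) ω : ℝ≥0∞))) μ :=
    (hX.iIndepFun_pointCount (fun y : f.range => f.measurableSet_fiber y) hdisj).comp
      (fun y (n : ℕ∞) => negExp (y * (n : ℝ≥0∞))) fun y => measurable_from_top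
  have hmeas (y : f.range) : Measurable fun ω =>
      negExp (y * (pointCount X (f ⁻¹' {(y : ℝ≥0∞)}) ω : ℝ≥0∞)) :=
    measurable_negExp.comp ((hX.measurable_pointCount (f.measurableSet_fiber y)).const_mul _)
  have hfiber (y : ℝ≥0∞) : ∫⁻ ω, negExp (y * (pointCount X (f ⁻¹' {y}) ω : ℝ≥0∞)) ∂μ
      = negExp ((1 - negExp y) * Λ (f ⁻¹' {y})) := by
    rcases eq_or_ne y 0 with rfl | hy
    · simp
    · exact hX.lintegral_negExp_mul_pointCount (f.measurableSet_fiber y) (hΛ y hy) y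
  have hintegral : ∫⁻ v, (1 - negExp (f v)) ∂Λ
      = ∑ y : f.range, (1 - negExp y) * Λ (f ⁻¹' {(y : ℝ≥0∞)}) := by
    rw [Finset.sum_coe_sort f.range fun y => (1 - negExp y) * Λ (f ⁻¹' {y}),
      ← f.map_lintegral fun y => 1 - negExp y, ← SimpleFunc.lintegral_eq_lintegral]
    rfl
  simp_rw [tsum_simpleFunc_eq_sum_mul_pointCount, negExp_sum]
  rw [lintegral_prod_eq_prod_lintegral_of_indepFun _ _ hindep hmeas, hintegral, negExp_sum]
  exact Finset.prod_congr rfl fun y _ => hfiber y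

theorem laplace [IsProbabilityMeasure μ] [SigmaFinite Λ] (hX : IsPoissonPointProcess X Λ μ)
    {φ : E → ℝ≥0∞} (hφ : Measurable φ) :
    ∫⁻ ω, negExp (∑' i, φ (X i ω)) ∂μ = negExp (∫⁻ v, (1 - negExp (φ v)) ∂Λ) := by
  obtain ⟨f, hfin, hmono, hlim⟩ := exists_simpleFunc_monotone_tendsto Λ hφ
  have hleft : Tendsto (fun n => ∫⁻ ω, negExp (∑' i, f n (X i ω)) ∂μ) atTop
      (𝓝 (∫⁻ ω, negExp (∑' i, φ (X i ω)) ∂μ)) := by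
    refine tendsto_lintegral_negExp (fun n => ?_) (ae_of_all _ fun ω => ?_)
    · exact (Measurable.tsum fun i => (f n).measurable.comp (hX.measurable i)).aemeasurable
    · exact (continuous_negExp.tendsto _).comp
        (tendsto_ennreal_tsum_of_monotone (fun i => hmono _) fun i => hlim _)
  have hright : Tendsto (fun n => negExp (∫⁻ v, (1 - negExp (f n v)) ∂Λ)) atTop
      (𝓝 (negExp (∫⁻ v, (1 - negExp (φ v)) ∂Λ))) := by
    refine (continuous_negExp.tendsto _).comp (lintegral_tendsto_of_tendsto_of_monotone
      (fun n => (measurable_const.sub (measurable_negExp.comp (f n).measurable)).aemeasurable)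
      (ae_of_all _ fun v m n hmn => tsub_le_tsub_left (antitone_negExp (hmono v hmn)) _)
      (ae_of_all _ fun v => ?_))
    exact ENNReal.Tendsto.sub tendsto_const_nhds ((continuous_negExp.tendsto _).comp (hlim v))
      (Or.inl ENNReal.one_ne_top)
  exact tendsto_nhds_unique hleft (hright.congr fun n => (hX.laplace_simpleFunc _ (hfin n)).symm)

end IsPoissonPointProcess

section Independence

variable {Ω α β γ : Type*} [MeasurableSpace Ω] [MeasurableSpace α] [MeasurableSpace β]
  [MeasurableSpace γ] {μ : Measure Ω} [IsProbabilityMeasure μ]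

lemma lintegral_comp_of_indepFun {f : Ω → α} {g : Ω → β} {ρ : Measure α} (hf : HasLaw f ρ μ)
    (hg : AEMeasurable g μ) (hfg : IndepFun f g μ) {F : α → β → ℝ≥0∞}
    (hF : Measurable fun p : α × β => F p.1 p.2) :
    ∫⁻ ω, F (f ω) (g ω) ∂μ = ∫⁻ ω, ∫⁻ x, F x (g ω) ∂ρ ∂μ := by
  have : IsProbabilityMeasure ρ := hf.isProbabilityMeasure_iff.1 ‹_›
  have : IsProbabilityMeasure (μ.map g) := Measure.isProbabilityMeasure_map hg
  have hlaw := hfg.hasLaw_prod hf ⟨hg, rfl⟩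
  rw [hlaw.lintegral_comp (f := fun p => F p.1 p.2) hF.aemeasurable,
    lintegral_prod_symm _ hF.aemeasurable,
    lintegral_map' hF.lintegral_prod_left'.aemeasurable hg]

lemma indepFun_prodMk_of_indepFun {f : Ω → α} {g : Ω → β} {k : Ω → γ} (hf : AEMeasurable f μ)
    (hg : AEMeasurable g μ) (hk : AEMeasurable k μ) (hfg : IndepFun f g μ)
    (hfgk : IndepFun (fun ω => (f ω, g ω)) k μ) : IndepFun f (fun ω => (g ω, k ω)) μ := by
  have hf_law : HasLaw f (μ.map f) μ := ⟨hf, rfl⟩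
  have hk_law : HasLaw k (μ.map k) μ := ⟨hk, rfl⟩
  have hfg_law := hfg.hasLaw_prod hf_law ⟨hg, rfl⟩
  have hgk : IndepFun g k μ := hfgk.comp measurable_snd measurable_id
  refine (indepFun_iff_hasLaw_prodMk_prod hf_law (hgk.hasLaw_prod ⟨hg, rfl⟩ hk_law)).2 ?_
  exact (measurePreserving_prodAssoc _ _ _).comp_hasLaw (hfgk.hasLaw_prod hfg_law hk_law)

lemma indepFun_comp_of_notMem_range {ι κ : Type*} {f : κ → Ω → α} (hindep : iIndepFun f μ)
    (hf : ∀ k, AEMeasurable (f k) μ) {k : κ} {e : ι → κ} (hk : k ∉ Set.range e) :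
    IndepFun (f k) (fun ω i => f (e i) ω) μ := by
  classical
  refine IndepFun.indepFun_process₀ (hf k) (fun i => hf (e i)) fun I => ?_
  have hdisj : Disjoint {k} (I.image e) := by
    simpa using fun i _ hi => hk ⟨i, hi⟩
  let φ : (({k} : Finset κ) → α) → α := fun x => x ⟨k, Finset.mem_singleton_self k⟩
  let ψ : (I.image e → α) → I → α := fun x i => x ⟨e i, Finset.mem_image_of_mem e i.2⟩
  exact (hindep.indepFun_finset₀ {k} (I.image e) hdisj hf).comp (φ := φ) (ψ := ψ)
    (measurable_pi_apply _) (measurable_pi_lambda _ fun i => measurable_pi_apply _)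

end Independence

/-- The random variables `Z i` are independent marks with law `κ` of the random points `X i`: they
are i.i.d. and independent of the points. -/
structure IsIndependentMarking {Ω E M : Type*} [MeasurableSpace Ω] [MeasurableSpace E]
    [MeasurableSpace M] (Z : ℕ → Ω → M) (κ : Measure M) (X : ℕ → Ω → E) (μ : Measure Ω) : Prop where
  hasLaw : ∀ i, HasLaw (Z i) κ μ
  iIndepFun : iIndepFun Z μ
  indepFun : IndepFun (fun ω i => Z i ω) (fun ω i => X i ω) μ

lemma lintegral_negExp_tsum_infinitePi {M : Type*} [MeasurableSpace M] {κ : Measure M}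
    [IsProbabilityMeasure κ] {f : ℕ → M → ℝ≥0∞} (hf : ∀ i, Measurable (f i)) {b : ℕ → ℝ≥0∞}
    (hb : ∀ i, ∫⁻ z, negExp (f i z) ∂κ = negExp (b i)) :
    ∫⁻ z, negExp (∑' i, f i (z i)) ∂(Measure.infinitePi fun _ : ℕ => κ) = negExp (∑' i, b i) := by
  have hindep : iIndepFun (fun i (z : ℕ → M) => negExp (f i (z i)))
      (Measure.infinitePi fun _ : ℕ => κ) :=
    iIndepFun_infinitePi fun i => measurable_negExp.comp (hf i)
  have hfinite (n : ℕ) : ∫⁻ z, negExp (∑ i ∈ Finset.range n, f i (z i))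
      ∂(Measure.infinitePi fun _ : ℕ => κ) = negExp (∑ i ∈ Finset.range n, b i) := by
    simp_rw [negExp_sum]
    rw [lintegral_prod_eq_prod_lintegral_of_indepFun _ _ hindep fun i => by fun_prop]
    refine Finset.prod_congr rfl fun i _ => ?_
    exact ((measurePreserving_eval_infinitePi (fun _ : ℕ => κ) i).lintegral_comp
      (measurable_negExp.comp (hf i))).trans (hb i)
  have hmeas (n : ℕ) : Measurable fun z : ℕ → M => ∑ i ∈ Finset.range n, f i (z i) :=
    Finset.measurable_fun_sum _ fun i _ => (hf i).comp (measurable_pi_apply i)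
  refine tendsto_nhds_unique (tendsto_lintegral_negExp (fun n => (hmeas n).aemeasurable)
    (ae_of_all _ fun z => tendsto_negExp_sum_range _)) ?_
  simpa only [hfinite] using tendsto_negExp_sum_range b

lemma ae_ne_top_of_tendsto_lintegral_negExp {Ω : Type*} [MeasurableSpace Ω] {μ : Measure Ω}
    [IsProbabilityMeasure μ] {Y : Ω → ℝ≥0∞} (hY : AEMeasurable Y μ) {T : ℕ → ℝ≥0∞}
    (hT : ∀ n, T n ≠ 0) (h : Tendsto (fun n => ∫⁻ ω, negExp (T n * Y ω) ∂μ) atTop (𝓝 1)) :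
    ∀ᵐ ω ∂μ, Y ω ≠ ⊤ := by
  have hS : NullMeasurableSet {ω | Y ω ≠ ⊤} μ :=
    hY.nullMeasurableSet_preimage (measurableSet_singleton ⊤).compl
  refine (prob_compl_eq_zero_iff₀ hS).2 (le_antisymm prob_le_one (le_of_tendsto' h fun n => ?_))
  rw [← lintegral_indicator_one₀ hS]
  refine lintegral_mono fun ω => ?_
  by_cases hω : Y ω = ⊤
  · simp [hω, ENNReal.mul_top (hT n)]
  · simpa [hω] using negExp_le_one _

namespace IsPoissonPointProcess

variable {Ω E M : Type*} [MeasurableSpace Ω] [MeasurableSpace E] [MeasurableSpace M]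
  {X : ℕ → Ω → E} {Λ : Measure E} {Z : ℕ → Ω → M} {κ : Measure M} {μ : Measure Ω}
  [IsProbabilityMeasure μ] [SigmaFinite Λ]

/- Given the points, the marks integrate out to `exp (-∑ φ (X i))`, where
`exp (-φ v) = ∫ exp (-F (v, z)) dκ z`. -/
theorem laplace_marked (hX : IsPoissonPointProcess X Λ μ) (hZ : IsIndependentMarking Z κ X μ)
    {F : E × M → ℝ≥0∞} (hF : Measurable F) :
    ∫⁻ ω, negExp (∑' i, F (X i ω, Z i ω)) ∂μ = negExp (∫⁻ p, (1 - negExp (F p)) ∂(Λ.prod κ)) := by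
  have : IsProbabilityMeasure κ := (hZ.hasLaw 0).isProbabilityMeasure_iff.1 ‹_›
  have hq_meas : Measurable fun v => ∫⁻ z, negExp (F (v, z)) ∂κ :=
    (measurable_negExp.comp hF).lintegral_prod_right'
  have hq_le (v : E) : ∫⁻ z, negExp (F (v, z)) ∂κ ≤ 1 :=
    (lintegral_mono fun z => negExp_le_one _).trans (by simp)
  let φ : E → ℝ≥0∞ := fun v => (-(ENNReal.log (∫⁻ z, negExp (F (v, z)) ∂κ))).toENNReal
  have hφ : Measurable φ := (ENNReal.measurable_log.comp hq_meas).neg.ereal_toENNReal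
  have hφ_eq (v : E) : negExp (φ v) = ∫⁻ z, negExp (F (v, z)) ∂κ :=
    negExp_toENNReal_neg_log (hq_le v)
  have hmarks : HasLaw (fun ω i => Z i ω) (Measure.infinitePi fun _ => κ) μ :=
    hZ.iIndepFun.hasLaw_infinitePi hZ.hasLaw
      (aemeasurable_pi_lambda _ fun i => (hZ.hasLaw i).aemeasurable)
  have hpoints : Measurable fun ω i => X i ω := measurable_pi_lambda _ hX.measurable
  calc ∫⁻ ω, negExp (∑' i, F (X i ω, Z i ω)) ∂μ
    _ = ∫⁻ ω, ∫⁻ z, negExp (∑' i, F (X i ω, z i)) ∂(Measure.infinitePi fun _ => κ) ∂μ :=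
        lintegral_comp_of_indepFun hmarks hpoints.aemeasurable hZ.indepFun
          (F := fun z x => negExp (∑' i, F (x i, z i))) (by fun_prop)
    _ = ∫⁻ ω, negExp (∑' i, φ (X i ω)) ∂μ := lintegral_congr fun ω =>
        lintegral_negExp_tsum_infinitePi (fun i => by fun_prop) fun i => (hφ_eq _).symm
    _ = negExp (∫⁻ v, (1 - negExp (φ v)) ∂Λ) := hX.laplace hφ
    _ = negExp (∫⁻ p, (1 - negExp (F p)) ∂(Λ.prod κ)) := by
        rw [lintegral_prod _ (by fun_prop)]
        congr 1
        refine lintegral_congr fun v => ?_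
        rw [hφ_eq, lintegral_sub (by fun_prop) ((hq_le v).trans_lt ENNReal.one_lt_top).ne
          (ae_of_all _ fun z => negExp_le_one _)]
        simp

theorem ae_tsum_marked_ne_top (hX : IsPoissonPointProcess X Λ μ)
    (hZ : IsIndependentMarking Z κ X μ) {F : E × M → ℝ≥0∞} (hF : Measurable F)
    (hF_ne_top : ∀ p, F p ≠ ⊤) (hint : ∫⁻ p, (1 - negExp (F p)) ∂(Λ.prod κ) ≠ ⊤) :
    ∀ᵐ ω ∂μ, ∑' i, F (X i ω, Z i ω) ≠ ⊤ := by
  let T : ℕ → ℝ≥0∞ := fun n => (n + 1)⁻¹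
  have hT_le (n : ℕ) : T n ≤ 1 := by simp [T]
  have hT_lim : Tendsto T atTop (𝓝 0) := by
    simpa [T] using (tendsto_add_atTop_iff_nat 1).2 ENNReal.tendsto_inv_nat_nhds_zero
  have hY : AEMeasurable (fun ω => ∑' i, F (X i ω, Z i ω)) μ := by
    refine AEMeasurable.tsum fun i => hF.comp_aemeasurable ?_
    exact (hX.measurable i).aemeasurable.prodMk (hZ.hasLaw i).aemeasurable
  refine ae_ne_top_of_tendsto_lintegral_negExp hY (T := T) (by simp [T]) ?_
  have hlaplace (n : ℕ) : ∫⁻ ω, negExp (T n * ∑' i, F (X i ω, Z i ω)) ∂μ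
      = negExp (∫⁻ p, (1 - negExp (T n * F p)) ∂(Λ.prod κ)) := by
    simp_rw [← ENNReal.tsum_mul_left]
    exact hX.laplace_marked hZ (hF.const_mul (T n))
  have hlim : Tendsto (fun n => ∫⁻ p, (1 - negExp (T n * F p)) ∂(Λ.prod κ)) atTop (𝓝 0) := by
    rw [← lintegral_zero (μ := Λ.prod κ)]
    refine tendsto_lintegral_of_dominated_convergence _ (fun n => by fun_prop)
      (fun n => ae_of_all _ fun p => ?_) hint (ae_of_all _ fun p => ?_)
    · exact tsub_le_tsub_left (antitone_negExp (mul_le_of_le_one_left' (hT_le n))) 1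
    · have hTF : Tendsto (fun n => T n * F p) atTop (𝓝 0) := by
        simpa using ENNReal.Tendsto.mul_const hT_lim (Or.inr (hF_ne_top p))
      simpa using ENNReal.Tendsto.sub tendsto_const_nhds
        ((continuous_negExp.tendsto 0).comp hTF) (Or.inl ENNReal.one_ne_top)
  simpa only [hlaplace, negExp_zero, Function.comp_def]
    using (continuous_negExp.tendsto 0).comp hlim

end IsPoissonPointProcess

/-! ### The exponential distribution -/

lemma expMeasure_setOf_lt_ofReal {r : ℝ} (hr : 0 < r) (y : ℝ≥0∞) :
    expMeasure r {x | y < ENNReal.ofReal x} = negExp (ENNReal.ofReal r * y) := by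
  have := isProbabilityMeasure_expMeasure hr
  rcases eq_or_ne y ⊤ with rfl | hy
  · simp [ENNReal.mul_top, hr]
  lift y to ℝ≥0 using hy
  have hset : {x : ℝ | (y : ℝ≥0∞) < ENNReal.ofReal x} = (Set.Iic (y : ℝ))ᶜ := by
    ext x
    simp [ENNReal.lt_ofReal_iff_toReal_lt]
  have hcdf := cdf_expMeasure_eq hr (y : ℝ)
  rw [cdf_eq_real, if_pos y.coe_nonneg] at hcdf
  rw [hset, ← ofReal_measureReal, measureReal_compl measurableSet_Iic, hcdf, probReal_univ,
    sub_sub_cancel, ← negExp_ofReal (by positivity), ENNReal.ofReal_mul hr.le,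
    ENNReal.ofReal_coe_nnreal]

lemma ae_pos_expMeasure {r : ℝ} (hr : 0 < r) : ∀ᵐ x ∂(expMeasure r), 0 < x := by
  have := isProbabilityMeasure_expMeasure hr
  refine (prob_compl_eq_zero_iff measurableSet_Ioi).2 ?_
  simpa [Set.Ioi_def] using expMeasure_setOf_lt_ofReal hr 0

lemma measure_lt_ofReal_of_hasLaw_expMeasure {Ω : Type*} [MeasurableSpace Ω] {μ : Measure Ω}
    [IsProbabilityMeasure μ] {r : ℝ} (hr : 0 < r) {H : Ω → ℝ} {Y : Ω → ℝ≥0∞}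
    (hH : HasLaw H (expMeasure r) μ) (hY : AEMeasurable Y μ) (hHY : IndepFun H Y μ) :
    μ {ω | Y ω < ENNReal.ofReal (H ω)} = ∫⁻ ω, negExp (ENNReal.ofReal r * Y ω) ∂μ := by
  have hS : MeasurableSet {p : ℝ × ℝ≥0∞ | p.2 < ENNReal.ofReal p.1} :=
    measurableSet_lt measurable_snd (by fun_prop)
  have : IsProbabilityMeasure (expMeasure r) := isProbabilityMeasure_expMeasure hr
  have : IsProbabilityMeasure (μ.map Y) := Measure.isProbabilityMeasure_map hY
  rw [(hHY.hasLaw_prod hH ⟨hY, rfl⟩).measure_eq (p := fun p => p.2 < ENNReal.ofReal p.1) hS,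
    Measure.prod_apply_symm hS]
  simp only [Set.preimage_ofPred_eq, expMeasure_setOf_lt_ofReal hr]
  exact lintegral_map' (by fun_prop) hY

lemma lintegral_negExp_ofReal_mul_expMeasure {r c : ℝ} (hr : 0 < r) (hc : 0 ≤ c) :
    ∫⁻ x, negExp (ENNReal.ofReal (c * x)) ∂(expMeasure r) = ENNReal.ofReal (r / (r + c)) := by
  have hpdf (s : ℝ) : Measurable (exponentialPDF s) :=
    (measurable_exponentialPDFReal s).ennreal_ofReal
  have htilt (x : ℝ) : exponentialPDF r x * negExp (ENNReal.ofReal (c * x))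
      = ENNReal.ofReal (r / (r + c)) * exponentialPDF (r + c) x := by
    rcases lt_or_ge x 0 with hx | hx
    · rw [exponentialPDF_of_neg hx, exponentialPDF_of_neg hx, zero_mul, mul_zero]
    · rw [exponentialPDF_of_nonneg hx, exponentialPDF_of_nonneg hx, negExp_ofReal (by positivity),
        ← ENNReal.ofReal_mul (by positivity), ← ENNReal.ofReal_mul (by positivity), mul_assoc,
        ← Real.exp_add, ← mul_assoc, div_mul_cancel₀ _ (by positivity)]
      congr 3
      ring
  calc ∫⁻ x, negExp (ENNReal.ofReal (c * x)) ∂(expMeasure r)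
    _ = ∫⁻ x, exponentialPDF r x * negExp (ENNReal.ofReal (c * x)) :=
        lintegral_withDensity_eq_lintegral_mul _ (hpdf r) (by fun_prop)
    _ = ENNReal.ofReal (r / (r + c)) * ∫⁻ x, exponentialPDF (r + c) x := by
        simp_rw [htilt, lintegral_const_mul _ (hpdf _)]
    _ = ENNReal.ofReal (r / (r + c)) := by
        rw [lintegral_exponentialPDF_eq_one (by positivity), mul_one]

lemma lintegral_one_sub_negExp_expMeasure {r c : ℝ} (hr : 0 < r) (hc : 0 ≤ c) :
    ∫⁻ x, (1 - negExp (ENNReal.ofReal (c * x))) ∂(expMeasure r) = ENNReal.ofReal (c / (r + c)) := by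
  have := isProbabilityMeasure_expMeasure hr
  have hlaplace := lintegral_negExp_ofReal_mul_expMeasure hr hc
  rw [lintegral_sub (by fun_prop) (by simp [hlaplace]) (ae_of_all _ fun x => negExp_le_one _),
    hlaplace, lintegral_one, measure_univ, ← ENNReal.ofReal_one,
    ← ENNReal.ofReal_sub _ (by positivity)]
  congr 1
  field_simp
  ring

/-! ### Euler's integral for the hypergeometric function -/

section ParametricIntegral

variable {ν : Measure ℝ} {w : ℝ → ℝ}

lemma le_norm_one_sub_mul {δ t : ℝ} {z : ℂ} (hδ : δ ≤ 1) (hz : z.re ≤ 1 - δ)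
    (ht : t ∈ Set.Icc (0 : ℝ) 1) : δ ≤ ‖1 - z * t‖ := by
  have hre : (1 - z * t).re = 1 - z.re * t := by simp
  refine le_trans ?_ (hre ▸ Complex.re_le_norm _)
  nlinarith [mul_le_mul_of_nonneg_right hz ht.1, mul_nonneg (sub_nonneg.2 hδ) (sub_nonneg.2 ht.2)]

lemma differentiableAt_integral_div_one_sub_mul (hw : Integrable w ν)
    (hν : ∀ᵐ t ∂ν, t ∈ Set.Icc (0 : ℝ) 1) {z₀ : ℂ} (hz₀ : z₀.re < 1) :
    DifferentiableAt ℂ (fun z : ℂ => ∫ t, (w t : ℂ) / (1 - z * t) ∂ν) z₀ := by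
  obtain ⟨δ, hδ, hδ_min⟩ := exists_between (lt_min one_pos (sub_pos.2 hz₀))
  obtain ⟨hδ_one, hδz₀⟩ := lt_min_iff.1 hδ_min
  have hs : {z : ℂ | z.re < 1 - δ} ∈ 𝓝 z₀ :=
    (isOpen_lt Complex.continuous_re continuous_const).mem_nhds (lt_sub_comm.1 hδz₀)
  have hlower {z : ℂ} (hz : z.re < 1 - δ) {t : ℝ} (ht : t ∈ Set.Icc (0 : ℝ) 1) :
      δ ≤ ‖1 - z * t‖ := le_norm_one_sub_mul hδ_one.le hz.le ht
  have hw_meas : AEStronglyMeasurable (fun t => (w t : ℂ)) ν := hw.ofReal.aestronglyMeasurable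
  have hmeas (z : ℂ) : AEStronglyMeasurable (fun t => (w t : ℂ) / (1 - z * t)) ν := by
    simp_rw [div_eq_mul_inv]
    exact hw_meas.mul (by fun_prop : Measurable fun t : ℝ => (1 - z * t)⁻¹).aestronglyMeasurable
  have hmeas_deriv : AEStronglyMeasurable (fun t => (w t : ℂ) * t / (1 - z₀ * t) ^ 2) ν := by
    simp_rw [div_eq_mul_inv, mul_assoc]
    exact hw_meas.mul
      (by fun_prop : Measurable fun t : ℝ => (t : ℂ) * ((1 - z₀ * t) ^ 2)⁻¹).aestronglyMeasurable
  have hint : Integrable (fun t => (w t : ℂ) / (1 - z₀ * t)) ν := by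
    refine (hw.norm.div_const δ).mono' (hmeas z₀) ?_
    filter_upwards [hν] with t ht
    rw [norm_div, Complex.norm_real]
    gcongr
    exact hlower (lt_sub_comm.1 hδz₀) ht
  refine (hasDerivAt_integral_of_dominated_loc_of_deriv_le
    (F' := fun z t => (w t : ℂ) * t / (1 - z * t) ^ 2) (bound := fun t => ‖w t‖ / δ ^ 2)
    hs (Eventually.of_forall hmeas) hint hmeas_deriv ?_ (hw.norm.div_const _) ?_).2.differentiableAt
  · filter_upwards [hν] with t ht z hz
    rw [norm_div, norm_mul, Complex.norm_real, Complex.norm_real, norm_pow]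
    gcongr
    · exact mul_le_of_le_one_right (norm_nonneg _) (by rw [Real.norm_of_nonneg ht.1]; exact ht.2)
    · exact hlower hz ht
  · filter_upwards [hν] with t ht z hz
    have hne : 1 - z * t ≠ 0 := norm_pos_iff.1 (hδ.trans_le (hlower hz ht))
    have hderiv : HasDerivAt (fun z : ℂ => 1 - z * t) (-(t : ℂ)) z := by
      simpa using ((hasDerivAt_id z).mul_const (t : ℂ)).const_sub 1
    exact ((hasDerivAt_const z (w t : ℂ)).fun_div hderiv hne).congr_deriv (by ring)

lemma analyticOnNhd_integral_div_one_sub_mul (hw : Integrable w ν)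
    (hν : ∀ᵐ t ∂ν, t ∈ Set.Icc (0 : ℝ) 1) :
    AnalyticOnNhd ℝ (fun x : ℝ => ∫ t, w t / (1 - x * t) ∂ν) (Set.Iio 1) := by
  intro x hx
  have hcomplex : AnalyticAt ℂ (fun z : ℂ => ∫ t, (w t : ℂ) / (1 - z * t) ∂ν) x := by
    refine DifferentiableOn.analyticAt (s := {z : ℂ | z.re < 1}) (fun z hz =>
      (differentiableAt_integral_div_one_sub_mul hw hν hz).differentiableWithinAt) ?_
    exact (isOpen_lt Complex.continuous_re continuous_const).mem_nhds hx
  refine AnalyticAt.congr ((Complex.reCLM.analyticAt _).comp (AnalyticAt.fun_comp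
    (f := fun y : ℝ => (y : ℂ)) hcomplex.restrictScalars (Complex.ofRealCLM.analyticAt x)))
    (Eventually.of_forall fun y => ?_)
  have hreal : ∫ t, (w t : ℂ) / (1 - (y : ℂ) * t) ∂ν = ((∫ t, w t / (1 - y * t) ∂ν : ℝ) : ℂ) := by
    rw [← integral_complex_ofReal]
    push_cast
    rfl
  simp [hreal]

lemma hasSum_integral_div_one_sub_mul (hw : Integrable w ν)
    (hν : ∀ᵐ t ∂ν, t ∈ Set.Icc (0 : ℝ) 1) {x : ℝ} (hx : |x| < 1) :
    HasSum (fun n : ℕ => (∫ t, w t * t ^ n ∂ν) * x ^ n) (∫ t, w t / (1 - x * t) ∂ν) := by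
  have hpow {t : ℝ} (ht : t ∈ Set.Icc (0 : ℝ) 1) (n : ℕ) : ‖w t * t ^ n‖ ≤ ‖w t‖ := by
    rw [norm_mul, norm_pow, Real.norm_of_nonneg ht.1]
    exact mul_le_of_le_one_right (norm_nonneg _) (pow_le_one₀ ht.1 ht.2)
  have hint (n : ℕ) : Integrable (fun t => w t * t ^ n) ν := by
    refine hw.norm.mono' (hw.aestronglyMeasurable.mul (by fun_prop)) ?_
    filter_upwards [hν] with t ht using hpow ht n
  have hle (n : ℕ) : ∫ t, ‖w t * t ^ n * x ^ n‖ ∂ν ≤ (∫ t, ‖w t‖ ∂ν) * |x| ^ n := by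
    rw [← integral_mul_const]
    refine integral_mono_ae ((hint n).mul_const (x ^ n)).norm (hw.norm.mul_const _) ?_
    filter_upwards [hν] with t ht
    rw [norm_mul, norm_pow, Real.norm_eq_abs x]
    gcongr
    exact hpow ht n
  have hsum := hasSum_integral_of_summable_integral_norm (μ := ν)
    (F := fun (n : ℕ) t => w t * t ^ n * x ^ n) (fun n => (hint n).mul_const (x ^ n))
    (Summable.of_nonneg_of_le (fun n => integral_nonneg fun t => norm_nonneg _) hle
      ((summable_geometric_of_lt_one (abs_nonneg x) hx).mul_left _))
  simp_rw [integral_mul_const] at hsum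
  have hgeom : ∫ t, ∑' n : ℕ, w t * t ^ n * x ^ n ∂ν = ∫ t, w t / (1 - x * t) ∂ν := by
    refine integral_congr_ae ?_
    filter_upwards [hν] with t ht
    have hxt : ‖x * t‖ < 1 := by
      rw [norm_mul, Real.norm_of_nonneg ht.1, Real.norm_eq_abs]
      exact (mul_le_of_le_one_right (abs_nonneg x) ht.2).trans_lt hx
    rw [div_eq_mul_inv, ← tsum_geometric_of_norm_lt_one hxt, ← tsum_mul_left]
    exact tsum_congr fun n => by ring
  exact hgeom ▸ hsum

end ParametricIntegral

lemma ascPochhammer_eval_add_one_mul (b : ℝ) (n : ℕ) :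
    (ascPochhammer ℝ n).eval (b + 1) * b = (ascPochhammer ℝ n).eval b * (b + n) := by
  induction n with
  | zero => simp
  | succ n ih =>
    rw [ascPochhammer_succ_eval, ascPochhammer_succ_eval]
    push_cast
    linear_combination (b + 1 + n) * ih

lemma ordinaryHypergeometric_one_add_one {b : ℝ} (hb : 0 < b) (x : ℝ) :
    ordinaryHypergeometric 1 b (b + 1) x = ∑' n : ℕ, b / (b + n) * x ^ n := by
  rw [ordinaryHypergeometric_eq_tsum]
  refine tsum_congr fun n => ?_
  have hpos : 0 < (ascPochhammer ℝ n).eval (b + 1) := ascPochhammer_pos n _ (by positivity)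
  have hfact : (n.factorial : ℝ) ≠ 0 := by positivity
  rw [ascPochhammer_eval_one, smul_eq_mul, inv_mul_cancel₀ hfact, one_mul, ← div_eq_mul_inv]
  congr 1
  rw [div_eq_div_iff hpos.ne' (by positivity), mul_comm b, ascPochhammer_eval_add_one_mul]

theorem isHypergeometricContinuation_one_add_one {b : ℝ} (hb : 0 < b) :
    IsHypergeometricContinuation 1 b (b + 1)
      (fun x => b * ∫ t in (0 : ℝ)..1, t ^ (b - 1) / (1 - x * t)) := by
  have hw : IntegrableOn (fun t : ℝ => t ^ (b - 1)) (Set.Ioc 0 1) :=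
    (intervalIntegral.intervalIntegrable_rpow' (by linarith)).1
  have hν : ∀ᵐ t ∂(volume.restrict (Set.Ioc (0 : ℝ) 1)), t ∈ Set.Icc (0 : ℝ) 1 :=
    (ae_restrict_mem measurableSet_Ioc).mono fun t ht => Set.Ioc_subset_Icc_self ht
  have hmoment (n : ℕ) : ∫ t in Set.Ioc (0 : ℝ) 1, t ^ (b - 1) * t ^ n = 1 / (b + n) := by
    have hrpow : ∀ t ∈ Set.Ioc (0 : ℝ) 1, t ^ (b - 1) * t ^ n = t ^ (b - 1 + n) := fun t ht => by
      rw [Real.rpow_add ht.1, Real.rpow_natCast]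
    have hn : (0 : ℝ) ≤ n := n.cast_nonneg
    rw [setIntegral_congr_fun measurableSet_Ioc hrpow,
      ← intervalIntegral.integral_of_le zero_le_one, integral_rpow (Or.inl (by linarith [hn])),
      Real.one_rpow, Real.zero_rpow (by linarith [hn])]
    congr 1 <;> ring
  simp_rw [intervalIntegral.integral_of_le zero_le_one]
  refine ⟨analyticOnNhd_const.mul (analyticOnNhd_integral_div_one_sub_mul hw hν), fun x hx => ?_⟩
  beta_reduce
  rw [ordinaryHypergeometric_one_add_one hb,
    ← (hasSum_integral_div_one_sub_mul hw hν hx).tsum_eq, ← tsum_mul_left]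
  exact tsum_congr fun n => by rw [hmoment]; ring

/-! ### Radial integrals -/

lemma integral_Ioi_one_comp_rpow_neg (g : ℝ → ℝ) {p : ℝ} (hp : 0 < p) :
    ∫ y in Set.Ioi (1 : ℝ), p * y ^ (-p - 1) * g (y ^ (-p)) = ∫ t in (0 : ℝ)..1, g t := by
  have hpow {y : ℝ} (hy : 0 < y) : y ^ (-p) < 1 ↔ 1 < y := by
    simpa only [Real.one_rpow] using Real.rpow_lt_rpow_iff_of_neg hy one_pos (neg_neg_of_pos hp)
  rw [intervalIntegral.integral_of_le zero_le_one, integral_Ioc_eq_integral_Ioo,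
    ← Set.Ioi_inter_Iio, ← setIntegral_indicator measurableSet_Iio,
    ← integral_comp_rpow_Ioi ((Set.Iio 1).indicator g) (neg_ne_zero.2 hp.ne'),
    ← Set.inter_eq_right.2 (Set.Ioi_subset_Ioi zero_le_one),
    ← setIntegral_indicator measurableSet_Ioi]
  refine setIntegral_congr_fun measurableSet_Ioi fun y hy => ?_
  simp [Set.indicator_apply, hpow hy, abs_of_pos hp]

lemma integral_Ioi_rpow_mul_div_one_add {d η a T : ℝ} (hη : 0 < η) (hd : d < η) (ha : 0 < a)
    (hT : 0 ≤ T) :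
    ∫ y in Set.Ioi a, y ^ (d - 1) * (T * y ^ (-η) / (1 + T * y ^ (-η)))
      = T * a ^ (d - η) / (η - d) *
        gaussHypergeometric 1 (1 - d / η) (2 - d / η) (-T / a ^ η) := by
  have hb : 0 < 1 - d / η := sub_pos.2 ((div_lt_one hη).2 hd)
  have hdη : η - d ≠ 0 := (sub_pos.2 hd).ne'
  have hx : -T / a ^ η < 1 :=
    (div_nonpos_of_nonpos_of_nonneg (neg_nonpos.2 hT) (by positivity)).trans_lt one_pos
  have hcoef : T * a ^ (d - η) / η = T * a ^ (d - η) / (η - d) * (1 - d / η) := by field_simp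
  have hscale (t : ℝ) (ht : t ∈ Set.Ioi (1 : ℝ)) :
      a * ((a * t) ^ (d - 1) * (T * (a * t) ^ (-η) / (1 + T * (a * t) ^ (-η))))
        = T * a ^ (d - η) / η *
          (η * t ^ (-η - 1) * ((t ^ (-η)) ^ (-(d / η)) / (1 - -T / a ^ η * t ^ (-η)))) := by
    have ht : 0 < t := one_pos.trans ht
    have hpow : a * (a * t) ^ (d - 1) * (a * t) ^ (-η)
        = a ^ (d - η) * (t ^ (-η - 1) * (t ^ (-η)) ^ (-(d / η))) := by
      rw [← Real.rpow_mul ht.le, show -η * -(d / η) = d by field_simp, ← Real.rpow_add ht,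
        mul_assoc, ← Real.rpow_add (mul_pos ha ht), Real.mul_rpow ha.le ht.le, ← mul_assoc,
        ← Real.rpow_one_add' ha.le (by linarith)]
      ring_nf
    have hden : 1 - -T / a ^ η * t ^ (-η) = 1 + T * (a * t) ^ (-η) := by
      rw [Real.mul_rpow ha.le ht.le, Real.rpow_neg ha.le]
      ring
    rw [hden]
    calc _ = T * (a * (a * t) ^ (d - 1) * (a * t) ^ (-η)) / (1 + T * (a * t) ^ (-η)) := by ring
      _ = _ := by rw [hpow]; field_simp
  rw [show 2 - d / η = 1 - d / η + 1 by ring,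
    (isHypergeometricContinuation_one_add_one hb).gaussHypergeometric_eq hx,
    sub_sub_cancel_left, ← integral_Ioi_one_comp_rpow_neg _ hη]
  calc ∫ y in Set.Ioi a, y ^ (d - 1) * (T * y ^ (-η) / (1 + T * y ^ (-η)))
    _ = ∫ t in Set.Ioi 1,
          a * ((a * t) ^ (d - 1) * (T * (a * t) ^ (-η) / (1 + T * (a * t) ^ (-η)))) := by
        rw [integral_const_mul, ← smul_eq_mul, integral_comp_mul_left_Ioi' (fun y =>
          y ^ (d - 1) * (T * y ^ (-η) / (1 + T * y ^ (-η)))) 1 ha, mul_one]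
    _ = _ := by
        rw [setIntegral_congr_fun measurableSet_Ioi hscale, integral_const_mul, hcoef, mul_assoc]

lemma integrableOn_Ioi_rpow_mul_div_one_add {d η a T : ℝ} (hd : d < η) (ha : 0 < a) (hT : 0 ≤ T) :
    IntegrableOn (fun y : ℝ => y ^ (d - 1) * (T * y ^ (-η) / (1 + T * y ^ (-η)))) (Set.Ioi a) := by
  refine ((integrableOn_Ioi_rpow_of_lt (show d - 1 - η < -1 by linarith) ha).const_mul T).mono'
    (by fun_prop) ?_
  filter_upwards [ae_restrict_mem measurableSet_Ioi] with y hy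
  have hy : 0 < y := ha.trans hy
  rw [Real.norm_of_nonneg (by positivity), sub_eq_add_neg (d - 1), Real.rpow_add hy]
  calc y ^ (d - 1) * (T * y ^ (-η) / (1 + T * y ^ (-η)))
    _ ≤ y ^ (d - 1) * (T * y ^ (-η)) := by
        gcongr
        exact div_le_self (by positivity) (le_add_of_nonneg_right (by positivity))
    _ = T * (y ^ (d - 1) * y ^ (-η)) := by ring

section Radial

variable {E F : Type*} [NormedAddCommGroup E] [NormedSpace ℝ E] [FiniteDimensional ℝ E]
  [Nontrivial E] [MeasurableSpace E] [BorelSpace E] (μ : Measure E) [μ.IsAddHaarMeasure]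
  [NormedAddCommGroup F] [NormedSpace ℝ F]

lemma integrableOn_fun_norm_compl_ball {f : ℝ → F} {a : ℝ} (ha : 0 < a) :
    IntegrableOn (fun v : E => f ‖v‖) {v | a ≤ ‖v‖} μ ↔
      IntegrableOn (fun y => y ^ (Module.finrank ℝ E - 1) • f y) (Set.Ioi a) := by
  have hf : {v : E | a ≤ ‖v‖}.indicator (fun v => f ‖v‖) =
      fun v => (Set.Ici a).indicator f ‖v‖ := rfl
  rw [← integrable_indicator_iff (measurableSet_le measurable_const measurable_norm),
    hf, integrable_fun_norm_addHaar]
  simp_rw [← Set.indicator_smul]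
  rw [integrableOn_indicator_iff measurableSet_Ici,
    Set.inter_eq_left.2 (Set.Ici_subset_Ioi.2 ha), integrableOn_Ici_iff_integrableOn_Ioi]

lemma setIntegral_fun_norm_compl_ball (f : ℝ → F) {a : ℝ} (ha : 0 < a) :
    ∫ v in {v : E | a ≤ ‖v‖}, f ‖v‖ ∂μ = Module.finrank ℝ E • μ.real (Metric.ball 0 1) •
      ∫ y in Set.Ioi a, y ^ (Module.finrank ℝ E - 1) • f y := by
  have hf : {v : E | a ≤ ‖v‖}.indicator (fun v => f ‖v‖) =
      fun v => (Set.Ici a).indicator f ‖v‖ := rfl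
  rw [← integral_indicator (measurableSet_le measurable_const measurable_norm),
    hf, integral_fun_norm_addHaar]
  simp_rw [← Set.indicator_smul]
  rw [setIntegral_indicator measurableSet_Ici,
    Set.inter_eq_right.2 (Set.Ici_subset_Ioi.2 ha), integral_Ici_eq_integral_Ioi]

lemma integrableOn_mul_norm_rpow_div_one_add {η a T : ℝ} (hη : Module.finrank ℝ E < η)
    (ha : 0 < a) (hT : 0 ≤ T) :
    IntegrableOn (fun v : E => T * ‖v‖ ^ (-η) / (1 + T * ‖v‖ ^ (-η))) {v | a ≤ ‖v‖} μ := by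
  rw [integrableOn_fun_norm_compl_ball μ (f := fun y => T * y ^ (-η) / (1 + T * y ^ (-η))) ha]
  simpa only [smul_eq_mul, ← Real.rpow_natCast, Nat.cast_pred Module.finrank_pos]
    using integrableOn_Ioi_rpow_mul_div_one_add hη ha hT

lemma setIntegral_mul_norm_rpow_div_one_add {η a T : ℝ} (hη : Module.finrank ℝ E < η)
    (ha : 0 < a) (hT : 0 ≤ T) :
    ∫ v in {v : E | a ≤ ‖v‖}, T * ‖v‖ ^ (-η) / (1 + T * ‖v‖ ^ (-η)) ∂μ =
      Module.finrank ℝ E * μ.real (Metric.ball 0 1) *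
        (T * a ^ (Module.finrank ℝ E - η) / (η - Module.finrank ℝ E) *
          gaussHypergeometric 1 (1 - Module.finrank ℝ E / η) (2 - Module.finrank ℝ E / η)
            (-T / a ^ η)) := by
  rw [setIntegral_fun_norm_compl_ball μ (fun y => T * y ^ (-η) / (1 + T * y ^ (-η))) ha,
    ← integral_Ioi_rpow_mul_div_one_add ((Nat.cast_nonneg _).trans_lt hη) hη ha hT]
  simp only [smul_eq_mul, nsmul_eq_mul, mul_assoc, ← Real.rpow_natCast,
    Nat.cast_pred Module.finrank_pos]

end Radial

/-! ### Exponential marks -/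

namespace IsPoissonPointProcess

variable {Ω E : Type*} [MeasurableSpace Ω] [MeasurableSpace E] {μ : Measure Ω}
  [IsProbabilityMeasure μ] {Λ : Measure E} [SigmaFinite Λ] {X : ℕ → Ω → E} {r : ℝ} {Z : ℕ → Ω → ℝ}

lemma laplace_exponential_marks (hX : IsPoissonPointProcess X Λ μ)
    (hr : 0 < r) (hZ : IsIndependentMarking Z (expMeasure r) X μ) {c : E → ℝ} (hc : Measurable c)
    (hc_nonneg : ∀ x, 0 ≤ c x) :
    ∫⁻ ω, negExp (∑' i, ENNReal.ofReal (c (X i ω) * Z i ω)) ∂μ =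
      negExp (∫⁻ x, ENNReal.ofReal (c x / (r + c x)) ∂Λ) := by
  have := isProbabilityMeasure_expMeasure hr
  have hF : Measurable fun p : E × ℝ => ENNReal.ofReal (c p.1 * p.2) := by fun_prop
  rw [hX.laplace_marked hZ hF, lintegral_prod _ (by fun_prop)]
  simp only [lintegral_one_sub_negExp_expMeasure hr (hc_nonneg _)]

lemma ae_summable_exponential_marks (hX : IsPoissonPointProcess X Λ μ)
    (hr : 0 < r) (hZ : IsIndependentMarking Z (expMeasure r) X μ) {c : E → ℝ} (hc : Measurable c)
    (hc_nonneg : ∀ x, 0 ≤ c x) (hint : ∫⁻ x, ENNReal.ofReal (c x / (r + c x)) ∂Λ ≠ ⊤) :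
    ∀ᵐ ω ∂μ, Summable fun i => c (X i ω) * Z i ω := by
  have := isProbabilityMeasure_expMeasure hr
  have hF : Measurable fun p : E × ℝ => ENNReal.ofReal (c p.1 * p.2) := by fun_prop
  have hfinite : ∀ᵐ ω ∂μ, ∑' i, ENNReal.ofReal (c (X i ω) * Z i ω) ≠ ⊤ := by
    refine hX.ae_tsum_marked_ne_top hZ hF (fun p => ENNReal.ofReal_ne_top) ?_
    rw [lintegral_prod _ (by fun_prop)]
    simpa only [lintegral_one_sub_negExp_expMeasure hr (hc_nonneg _)] using hint
  have hZ_pos : ∀ᵐ ω ∂μ, ∀ i, 0 < Z i ω :=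
    ae_all_iff.2 fun i => ((hZ.hasLaw i).ae_iff measurableSet_Ioi.mem).2 (ae_pos_expMeasure hr)
  filter_upwards [hfinite, hZ_pos] with ω hω hZω
  exact (ENNReal.summable_toReal hω).congr fun i =>
    ENNReal.toReal_ofReal (mul_nonneg (hc_nonneg _) (hZω i).le)

end IsPoissonPointProcess

/-! ### The signal-to-interference-plus-noise ratio -/

lemma lintegral_interfererIntensity (lam : ℝ) {R η T : ℝ} (hR : 0 < R) (hη : 2 < η) (hT : 0 ≤ T) :
    ∫⁻ v, ENNReal.ofReal (T * ‖v‖ ^ (-η) / (1 + T * ‖v‖ ^ (-η))) ∂(interfererIntensity lam R) =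
      ENNReal.ofReal (lam * ∫ v in {v : Plane | √3 * R / 2 ≤ ‖v‖},
        T * ‖v‖ ^ (-η) / (1 + T * ‖v‖ ^ (-η))) := by
  have hη' : (Module.finrank ℝ Plane : ℝ) < η := by simpa using hη
  have hint := integrableOn_mul_norm_rpow_div_one_add (volume : Measure Plane) hη'
    (show 0 < √3 * R / 2 by positivity) hT
  have hpos (v : Plane) : 0 ≤ T * ‖v‖ ^ (-η) / (1 + T * ‖v‖ ^ (-η)) := by positivity
  rw [interfererIntensity, lintegral_smul_measure,
    ← ofReal_integral_eq_lintegral_ofReal hint (ae_of_all _ hpos), smul_eq_mul,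
    ENNReal.ofReal_mul' (integral_nonneg hpos)]

lemma setIntegral_plane_mul_norm_rpow_div_one_add {η a T : ℝ} (hη : 2 < η) (ha : 0 < a)
    (hT : 0 ≤ T) :
    ∫ v in {v : Plane | a ≤ ‖v‖}, T * ‖v‖ ^ (-η) / (1 + T * ‖v‖ ^ (-η)) =
      2 * Real.pi * T * a ^ (2 - η) / (η - 2) *
        gaussHypergeometric 1 (1 - 2 / η) (2 - 2 / η) (-T / a ^ η) := by
  have hdim : (Module.finrank ℝ Plane : ℝ) = 2 := by simp
  have hball : (volume : Measure Plane).real (Metric.ball 0 1) = Real.pi := by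
    simp [measureReal_def, Real.pi_nonneg]
  rw [setIntegral_mul_norm_rpow_div_one_add volume (hdim ▸ hη) ha hT, hdim, hball]
  ring

lemma lt_mul_rpow_neg_div_iff {P r η Ξ H D : ℝ} (hP : 0 < P) (hr : 0 < r) (hD : 0 < D) :
    Ξ < P * H * r ^ (-η) / D ↔ Ξ * r ^ η / P * D < H := by
  rw [lt_div_iff₀ hD, Real.rpow_neg hr.le, ← div_eq_mul_inv, lt_div_iff₀ (by positivity),
    div_mul_eq_mul_div, div_lt_iff₀ hP, mul_right_comm, mul_comm P]

lemma lt_sinr_iff {Ω : Type*} {P η σ ro Ξ : ℝ} {X : ℕ → Ω → Plane} {h : Option ℕ → Ω → ℝ} {ω : Ω}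
    (hP : 0 < P) (hro : 0 < ro) (hΞ : 0 ≤ Ξ) (hh : ∀ k, 0 < h k ω) (hX : ∀ i, X i ω ≠ 0)
    (hsum : Summable (interferencePower P η X h ω)) :
    Ξ < sinr P η σ ro X h ω ↔ ENNReal.ofReal (Ξ * ro ^ η * σ ^ 2 / P) +
      ∑' i, ENNReal.ofReal (Ξ * ro ^ η * ‖X i ω‖ ^ (-η) * h (some i) ω)
        < ENNReal.ofReal (h none ω) := by
  have hpos (i : ℕ) : 0 < interferencePower P η X h ω i :=
    mul_pos (mul_pos hP (hh _)) (Real.rpow_pos_of_pos (norm_pos_iff.2 (hX i)) _)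
  have hterm (i : ℕ) : Ξ * ro ^ η * ‖X i ω‖ ^ (-η) * h (some i) ω
      = Ξ * ro ^ η / P * interferencePower P η X h ω i := by
    rw [interferencePower]
    field_simp
  have htotal : 0 < ∑' i, interferencePower P η X h ω i :=
    hsum.tsum_pos (fun i => (hpos i).le) 0 (hpos 0)
  simp_rw [hterm]
  rw [← ENNReal.ofReal_tsum_of_nonneg (fun i => mul_nonneg (by positivity) (hpos i).le)
      (hsum.mul_left _), tsum_mul_left, ← ENNReal.ofReal_add (by positivity) (by positivity),
    ENNReal.ofReal_lt_ofReal_iff (hh none), sinr, lt_mul_rpow_neg_div_iff hP hro (by positivity)]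
  ring_nf

lemma sinrThreshold_nonneg {L ζ W Ts : ℝ} {m : ℕ} (hL : 0 ≤ L) (hζ : 0 ≤ ζ) (hW : 0 ≤ W)
    (hTs : 0 ≤ Ts) : 0 ≤ sinrThreshold L m ζ W Ts :=
  sub_nonneg.2 (Real.one_le_rpow one_le_two (by positivity))

instance (lam R : ℝ) : SigmaFinite (interfererIntensity lam R) := by
  unfold interfererIntensity
  rw [ENNReal.ofReal]
  exact SMul.sigmaFinite lam.toNNReal

namespace IsTwoDimPPPModel

variable {Ω : Type*} [MeasurableSpace Ω] {μ : Measure Ω} {lam R : ℝ}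
  {X : ℕ → Ω → Plane} {h : Option ℕ → Ω → ℝ}

lemma isIndependentMarking (hmodel : IsTwoDimPPPModel μ lam R X h) :
    IsIndependentMarking (fun i => h (some i)) (expMeasure 1) X μ where
  hasLaw i := hmodel.fading_law (some i)
  iIndepFun := hmodel.fading_indep.precomp (Option.some_injective ℕ)
  indepFun := hmodel.fading_indep_locations.comp
    (measurable_pi_lambda _ fun i => measurable_pi_apply (some i)) measurable_id

lemma ae_fading_pos (hmodel : IsTwoDimPPPModel μ lam R X h) : ∀ᵐ ω ∂μ, ∀ k, 0 < h k ω :=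
  ae_all_iff.2 fun k =>
    ((hmodel.fading_law k).ae_iff measurableSet_Ioi.mem).2 (ae_pos_expMeasure one_pos)

lemma ae_location_ne_zero (hmodel : IsTwoDimPPPModel μ lam R X h) :
    ∀ᵐ ω ∂μ, ∀ i, X i ω ≠ 0 :=
  hmodel.locations.ae_notMem (measurableSet_singleton 0) (by simp [interfererIntensity])

variable [IsProbabilityMeasure μ]

lemma indepFun_none (hmodel : IsTwoDimPPPModel μ lam R X h) :
    IndepFun (h none) (fun ω => (fun i => h (some i) ω, fun i => X i ω)) μ := by
  have hh (k : Option ℕ) : AEMeasurable (h k) μ := (hmodel.fading_law k).aemeasurable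
  refine indepFun_prodMk_of_indepFun (hh none) (aemeasurable_pi_lambda _ fun i => hh (some i))
    (aemeasurable_pi_lambda _ fun i => (hmodel.locations.measurable i).aemeasurable)
    (indepFun_comp_of_notMem_range hmodel.fading_indep hh (by simp)) ?_
  exact hmodel.fading_indep_locations.comp
    (φ := fun g : Option ℕ → ℝ => (g none, fun i => g (some i))) (by fun_prop) measurable_id

lemma ae_summable_interferencePower (hmodel : IsTwoDimPPPModel μ lam R X h) (P : ℝ) {η : ℝ}
    (hR : 0 < R) (hη : 2 < η) : ∀ᵐ ω ∂μ, Summable (interferencePower P η X h ω) := by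
  have hint : ∫⁻ v, ENNReal.ofReal (‖v‖ ^ (-η) / (1 + ‖v‖ ^ (-η)))
      ∂(interfererIntensity lam R) ≠ ⊤ := by
    simpa only [one_mul] using
      (lintegral_interfererIntensity lam hR hη zero_le_one).trans_ne ENNReal.ofReal_ne_top
  filter_upwards [hmodel.locations.ae_summable_exponential_marks one_pos
    hmodel.isIndependentMarking (c := fun v => ‖v‖ ^ (-η)) (by fun_prop)
    (fun v => by positivity) hint] with ω hω
  exact (hω.mul_left P).congr fun i => by rw [interferencePower]; ring

lemma measure_add_tsum_lt_fading (hmodel : IsTwoDimPPPModel μ lam R X h) (y : ℝ≥0∞) (η : ℝ)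
    {T : ℝ} (hT : 0 ≤ T) :
    μ {ω | y + ∑' i, ENNReal.ofReal (T * ‖X i ω‖ ^ (-η) * h (some i) ω)
        < ENNReal.ofReal (h none ω)} =
      negExp (y + ∫⁻ v, ENNReal.ofReal (T * ‖v‖ ^ (-η) / (1 + T * ‖v‖ ^ (-η)))
        ∂(interfererIntensity lam R)) := by
  let load : (ℕ → ℝ) × (ℕ → Plane) → ℝ≥0∞ := fun p =>
    y + ∑' i, ENNReal.ofReal (T * ‖p.2 i‖ ^ (-η) * p.1 i)
  have hload : Measurable load := by fun_prop
  have hpair : AEMeasurable (fun ω => (fun i => h (some i) ω, fun i => X i ω)) μ :=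
    (aemeasurable_pi_lambda _ fun i => (hmodel.fading_law (some i)).aemeasurable).prodMk
      (aemeasurable_pi_lambda _ fun i => (hmodel.locations.measurable i).aemeasurable)
  have hprob := measure_lt_ofReal_of_hasLaw_expMeasure one_pos (hmodel.fading_law none)
    (hload.comp_aemeasurable hpair) (hmodel.indepFun_none.comp measurable_id hload)
  rw [negExp_add, ← hmodel.locations.laplace_exponential_marks one_pos
    hmodel.isIndependentMarking (c := fun v => T * ‖v‖ ^ (-η)) (by fun_prop)
    (fun v => by positivity)]
  simpa only [load, Function.comp_apply, ENNReal.ofReal_one, one_mul, negExp_add,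
    lintegral_const_mul' _ _ (ne_top_of_le_ne_top ENNReal.one_ne_top (negExp_le_one y))]
    using hprob

end IsTwoDimPPPModel

theorem corollary4_general {Ω : Type*} [MeasurableSpace Ω] (μ : Measure Ω)
    [IsProbabilityMeasure μ] (lam R P η σ ro Ξ : ℝ) (hlam : 0 ≤ lam) (hR : 0 < R) (hP : 0 < P)
    (hη : 2 < η) (hro : 0 < ro) (hΞ : 0 ≤ Ξ) (X : ℕ → Ω → Plane) (h : Option ℕ → Ω → ℝ)
    (hmodel : IsTwoDimPPPModel μ lam R X h) :
    (∀ᵐ ω ∂μ, Summable (interferencePower P η X h ω)) ∧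
    successProb μ P η σ ro Ξ X h =
      Real.exp (-(Ξ * ro ^ η * σ ^ 2 / P)
        - lam * (2 * Real.pi * (Ξ * ro ^ η) * (√3 * R / 2) ^ (2 - η) / (η - 2)
          * gaussHypergeometric 1 (1 - 2 / η) (2 - 2 / η)
              (-(Ξ * ro ^ η) / (√3 * R / 2) ^ η))) := by
  have hT : 0 ≤ Ξ * ro ^ η := by positivity
  have hsum := hmodel.ae_summable_interferencePower P hR hη
  have hevent : {ω | Ξ < sinr P η σ ro X h ω} =ᵐ[μ]
      {ω | ENNReal.ofReal (Ξ * ro ^ η * σ ^ 2 / P) +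
        ∑' i, ENNReal.ofReal (Ξ * ro ^ η * ‖X i ω‖ ^ (-η) * h (some i) ω)
          < ENNReal.ofReal (h none ω)} := by
    filter_upwards [hmodel.ae_fading_pos, hmodel.ae_location_ne_zero, hsum] with ω hh hX hω
    exact propext (lt_sinr_iff hP hro hΞ hh hX hω)
  have hexponent : 0 ≤ lam * ∫ v in {v : Plane | √3 * R / 2 ≤ ‖v‖},
      Ξ * ro ^ η * ‖v‖ ^ (-η) / (1 + Ξ * ro ^ η * ‖v‖ ^ (-η)) :=
    mul_nonneg hlam (integral_nonneg fun v => by positivity)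
  refine ⟨hsum, ?_⟩
  rw [successProb, measureReal_def, measure_congr hevent,
    hmodel.measure_add_tsum_lt_fading _ η hT, lintegral_interfererIntensity lam hR hη hT,
    ← ENNReal.ofReal_add (by positivity) hexponent,
    negExp_ofReal (add_nonneg (by positivity) hexponent), ENNReal.toReal_ofReal (Real.exp_nonneg _),
    setIntegral_plane_mul_norm_rpow_div_one_add hη (by positivity) hT, neg_add']

end

theorem corollary4 {Ω : Type*} [MeasurableSpace Ω] (μ : Measure Ω) [IsProbabilityMeasure μ]
    (Δx Δy R P η σ ro L ζ W Ts : ℝ) (NG m : ℕ)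
    (hΔx : 0 < Δx) (hΔy : 0 < Δy) (hR : 0 < R) (hNG : 0 < NG) (hP : 0 < P) (hη : 2 < η)
    (hro : 0 < ro) (hL : 0 < L) (hm : 0 < m) (hζ : 0 < ζ) (hζ1 : ζ ≤ 1) (hW : 0 < W)
    (hTs : 0 < Ts)
    (X : ℕ → Ω → Plane) (h : Option ℕ → Ω → ℝ)
    (hmodel : IsTwoDimPPPModel μ (activeDensity Δx Δy NG) R X h) :
    (∀ᵐ ω ∂μ, Summable (interferencePower P η X h ω)) ∧
    successProb μ P η σ ro (sinrThreshold L m ζ W Ts) X h =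
      Real.exp
        (-(sinrThreshold L m ζ W Ts * ro ^ η * σ ^ 2 / P)
          - 2 * Real.pi * sinrThreshold L m ζ W Ts * ro ^ η * (√3 * R / 2) ^ (2 - η)
              / (Δx * Δy * NG * (η - 2))
            * gaussHypergeometric 1 (1 - 2 / η) (2 - 2 / η)
                (-(sinrThreshold L m ζ W Ts * ro ^ η) / (√3 * R / 2) ^ η)) := by
  have hlam : 0 ≤ activeDensity Δx Δy NG := by unfold activeDensity; positivity
  have hΞ : 0 ≤ sinrThreshold L m ζ W Ts := sinrThreshold_nonneg hL.le hζ.le hW.le hTs.le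
  obtain ⟨hsum, hprob⟩ :=
    corollary4_general μ _ R P η σ ro _ hlam hR hP hη hro hΞ X h hmodel
  refine ⟨hsum, hprob.trans ?_⟩
  unfold activeDensity
  field_simp
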